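/- Let $K$ be a topological space and let $Y$ be a Banach space. For a topological space $L$, let $C_b(L,Y)$ denote the Banach space of all bounded continuous functions $f:L\to Y$ with the norm $\|f\|=\sup_{t\in L}\|f(t)\|$. Let $(K_n)_{n\in\mathbb N}$ be a sequence of subsets of $K$, each with the subspace topology, and let $(X_n)_{n\in\mathbb N}$ be a sequence of Banach spaces, all Banach spaces being over the same scalar field $\mathbb R$ or $\mathbb C$. Assume that 1. $\bigcup_{n\in\mathbb N}K_n=K$; 2. $K_n\subset \operatorname{int}(K_{n+1})$ for each $n\in\mathbb N$, the interior being taken in $K$; 3. for each $n\in\mathbb N$, $X_n$ does not embed into $C_b(K_n,Y)$; that is, there is no bounded linear operator $T:X_n\to C_b(K_n,Y)$ for which some $C>0$ satisfies $C\|u\|\le\|T(u)\|$ for all $u\in X_n$. Then $C_b(K,Y)$ has no complemented subspace isomorphic to $\left(\bigoplus_{n\in\mathbb N}X_n\right)_{c_0}$, the space of all sequences $(x_n)_n$ with $x_n\in X_n$ and $\|x_n\|\to0$, with the norm $\sup_n\|x_n\|$. Here a subspace is complemented if it is the image of a bounded linear projection of the whole space, and two normed spaces are isomorphic if there is a bounded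 linear bijection between them with bounded inverse. -/

import Mathlib

open Filter Topology
open scoped BoundedContinuousFunction ENNReal

/-- `X` embeds linearly into `Y`: there is a bounded linear operator `T : X → Y` which is bounded
below, i.e. `C * ‖u‖ ≤ ‖T u‖` for all `u`, for some `C > 0`. -/
def LinearlyEmbeds (𝕜 : Type*) [RCLike 𝕜] (X Y : Type*)
    [NormedAddCommGroup X] [NormedSpace 𝕜 X] [NormedAddCommGroup Y] [NormedSpace 𝕜 Y] : Prop :=
  ∃ T : X →L[𝕜] Y, ∃ C : ℝ, 0 < C ∧ ∀ u : X, C * ‖u‖ ≤ ‖T u‖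

/-- The `c₀`-sum of a family of normed spaces: the families `(x i)` such that `‖x i‖` tends to `0`
along the cofinite filter, as a subspace of the `ℓ^∞`-sum, hence with the supremum norm. -/
def c0Sum (𝕜 : Type*) [RCLike 𝕜] {ι : Type*} (X : ι → Type*)
    [∀ i, NormedAddCommGroup (X i)] [∀ i, NormedSpace 𝕜 (X i)] : Submodule 𝕜 (lp X ∞) where
  carrier := {x | Tendsto (fun i => ‖x i‖) cofinite (𝓝 0)}
  zero_mem' := by simpa using tendsto_const_nhds
  add_mem' := by
    intro x y hx hy
    have h := Tendsto.add (Set.mem_ofPred_eq ▸ hx) (Set.mem_ofPred_eq ▸ hy)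
    rw [add_zero] at h
    exact squeeze_zero (fun i => norm_nonneg _) (fun i => norm_add_le _ _) h
  smul_mem' := by
    intro c x hx
    have h := Tendsto.const_mul ‖c‖ (Set.mem_ofPred_eq ▸ hx)
    rw [mul_zero] at h
    exact squeeze_zero (fun i => norm_nonneg _) (fun i => norm_smul_le _ _) h

/-- `Y` has a complemented subspace isomorphic to `X`: some subspace `Z` of `Y` is the range of a
bounded linear projection of `Y` and is linearly homeomorphic to `X`. -/
def HasComplementedCopy (𝕜 : Type*) [RCLike 𝕜] (X Y : Type*)
    [NormedAddCommGroup X] [NormedSpace 𝕜 X] [NormedAddCommGroup Y] [NormedSpace 𝕜 Y] : Prop :=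
  ∃ Z : Submodule 𝕜 Y, Z.ClosedComplemented ∧ Nonempty (X ≃L[𝕜] Z)

/-!
The idea is that a complemented copy of the `c₀`-sum in `K →ᵇ Y` would make `c₀` complemented in
`ℓ^∞`, which Phillips' theorem forbids.

Let `S : c0Sum 𝕜 X → (K →ᵇ Y)` be the embedding and `R` a left inverse of it, obtained from the
projection. As `X n` does not embed into `Ks n →ᵇ Y`, there is a unit vector `x n` of `X n` whose
image `g n` under `S` has norm at most `2⁻ⁿ` on `Ks n`. For a bounded scalar sequence `a`, the
series `∑ a n • g n` converges uniformly on each `Ks m`, hence has a continuous sum on `K` because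
the interiors of the `Ks m` cover `K`; and the sum is bounded, since in the `c₀`-sum the partial sums
of `∑ a n • x n` have norm at most `‖a‖`. This gives an operator `T : ℓ^∞ → (K →ᵇ Y)` sending the
`n`-th unit sequence to `g n` (`exists_sum_operator`). If `φ n` is a norming functional of `x n`,
then each functional `a ↦ a n - φ n ((R (T a)) n)` on `ℓ^∞` vanishes on the unit sequences.

By Whitley's argument (`countable_ne_zero_of_almostDisjoint`), such a functional vanishes on the
indicators of all but countably many members of any almost disjoint family of subsets of `ℕ`.
Since there is an uncountable almost disjoint family of infinite sets
(`exists_almostDisjoint_family`), one of its members `A` has an indicator killed by all the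
functionals at once. Then `‖(R (T 1_A)) n‖ ≥ 1` for all `n ∈ A`, so `R (T 1_A)` is not a null
sequence.
-/

/-! ### Almost disjoint families -/

/-- The branches of the binary tree form an uncountable family of infinite sets with pairwise
finite intersections. -/
theorem exists_almostDisjoint_family :
    ∃ A : (ℕ → Bool) → Set ℕ, (∀ r, (A r).Infinite) ∧ ∀ r s, r ≠ s → (A r ∩ A s).Finite := by
  let b : (ℕ → Bool) → ℕ → ℕ := fun r n => Encodable.encode ((List.range n).map r)
  refine ⟨fun r => Set.range (b r), fun r => Set.infinite_range_of_injective fun m n h => ?_,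
    fun r s hrs => ?_⟩
  · simpa using congrArg List.length (Encodable.encode_injective h)
  · obtain ⟨p, hp⟩ := Function.ne_iff.1 hrs
    refine ((Set.finite_Iic p).image (b r)).subset ?_
    rintro _ ⟨⟨n, rfl⟩, ⟨m, hm⟩⟩
    refine ⟨n, ?_, rfl⟩
    have h := Encodable.encode_injective hm
    have hmn : m = n := by simpa using congrArg List.length h
    subst hmn
    by_contra hlt
    exact hp (List.map_inj_left.1 h p (List.mem_range.2 (not_le.1 hlt))).symm

/-! ### Functionals on `ℓ^∞` vanishing on the unit sequences -/

section BoundedSequences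

variable (𝕜 : Type*) [RCLike 𝕜]

/-- The indicator of a set of natural numbers, as an element of `ℓ^∞`. The space `ℓ^∞` is encoded
as the space of bounded continuous functions on the discrete space `ℕ`. -/
noncomputable def boundedIndicator (A : Set ℕ) : ℕ →ᵇ 𝕜 :=
  BoundedContinuousFunction.ofNormedAddCommGroupDiscrete (A.indicator fun _ => 1) 1 fun n =>
    (norm_indicator_le_norm_self _ n).trans (by simp)

variable {𝕜}

theorem boundedIndicator_apply (A : Set ℕ) (n : ℕ) :
    boundedIndicator 𝕜 A n = A.indicator (fun _ => 1) n := rfl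

theorem boundedIndicator_of_mem {A : Set ℕ} {n : ℕ} (h : n ∈ A) : boundedIndicator 𝕜 A n = 1 := by
  simp [boundedIndicator_apply, h]

theorem boundedIndicator_of_notMem {A : Set ℕ} {n : ℕ} (h : n ∉ A) :
    boundedIndicator 𝕜 A n = 0 := by
  simp [boundedIndicator_apply, h]

/-- A functional on `ℓ^∞` vanishing on the unit sequences is bounded by the supremum norm off any
finite set. -/
theorem norm_le_of_forall_notMem_finset {q : (ℕ →ᵇ 𝕜) →L[𝕜] 𝕜}
    (hq : ∀ n, q (boundedIndicator 𝕜 {n}) = 0) (a : ℕ →ᵇ 𝕜) (F : Finset ℕ) {C : ℝ} (hC : 0 ≤ C)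
    (ha : ∀ n ∉ F, ‖a n‖ ≤ C) : ‖q a‖ ≤ ‖q‖ * C := by
  set b : ℕ →ᵇ 𝕜 := a - ∑ n ∈ F, a n • boundedIndicator 𝕜 {n} with hb
  have hqb : q b = q a := by simp [hb, hq]
  have happ : ∀ m, b m = if m ∈ F then 0 else a m := by
    intro m
    have h : ∀ n, boundedIndicator 𝕜 {n} m = if m = n then 1 else 0 := fun n => by
      simp [boundedIndicator_apply, Set.indicator_apply]
    simp only [hb, BoundedContinuousFunction.coe_sub, BoundedContinuousFunction.coe_sum,
      Pi.sub_apply, Finset.sum_apply, BoundedContinuousFunction.coe_smul, h, smul_eq_mul, mul_ite,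
      mul_one, mul_zero, Finset.sum_ite_eq]
    split_ifs <;> simp
  rw [← hqb]
  refine (q.le_opNorm b).trans (mul_le_mul_of_nonneg_left ?_ (norm_nonneg q))
  refine (BoundedContinuousFunction.norm_le hC).2 fun m => ?_
  rw [happ]
  split_ifs with hm
  · simpa using hC
  · exact ha m hm

/-- Off a finite set, a combination with unimodular coefficients of the indicators of finitely many
almost disjoint sets has modulus at most `1`; so a functional vanishing on the unit sequences cannot
be large on many of them. -/
theorem sum_norm_le_of_almostDisjoint {q : (ℕ →ᵇ 𝕜) →L[𝕜] 𝕜}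
    (hq : ∀ n, q (boundedIndicator 𝕜 {n}) = 0) {ι : Type*} {A : ι → Set ℕ}
    (hA : ∀ i j, i ≠ j → (A i ∩ A j).Finite) (s : Finset ι) :
    ∑ i ∈ s, ‖q (boundedIndicator 𝕜 (A i))‖ ≤ ‖q‖ := by
  classical
  have hc : ∀ z : 𝕜, ∃ c : 𝕜, ‖c‖ ≤ 1 ∧ c * z = (‖z‖ : 𝕜) := by
    intro z
    rcases eq_or_ne z 0 with rfl | hz
    · exact ⟨0, by simp⟩
    · have hz' : (‖z‖ : 𝕜) ≠ 0 := by simpa using hz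
      refine ⟨(‖z‖ : 𝕜) / z, ?_, by field_simp⟩
      rw [norm_div, RCLike.norm_ofReal, abs_norm, div_self (by simpa using hz)]
  choose c hc1 hc2 using fun i => hc (q (boundedIndicator 𝕜 (A i)))
  let F : Finset ℕ := s.offDiag.biUnion fun p => if h : p.1 ≠ p.2 then (hA _ _ h).toFinset else ∅
  have hF : ∀ n ∉ F, ∀ i ∈ s, ∀ j ∈ s, n ∈ A i → n ∈ A j → i = j := by
    intro n hn i hi j hj hni hnj
    by_contra hij
    refine hn (Finset.mem_biUnion.2 ⟨(i, j), Finset.mem_offDiag.2 ⟨hi, hj, hij⟩, ?_⟩)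
    simp [hij, hni, hnj]
  have key := norm_le_of_forall_notMem_finset hq
    (∑ i ∈ s, c i • boundedIndicator 𝕜 (A i)) F zero_le_one fun n hn => by
      simp only [BoundedContinuousFunction.coe_sum, Finset.sum_apply,
        BoundedContinuousFunction.coe_smul, smul_eq_mul]
      by_cases h : ∃ i ∈ s, n ∈ A i
      · obtain ⟨i, hi, hni⟩ := h
        rw [Finset.sum_eq_single_of_mem i hi fun j hj hji => by
          rw [boundedIndicator_of_notMem fun hnj => hji (hF n hn j hj i hi hnj hni), mul_zero]]
        simpa [boundedIndicator_of_mem hni] using hc1 i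
      · push Not at h
        rw [Finset.sum_eq_zero fun i hi => by rw [boundedIndicator_of_notMem (h i hi), mul_zero]]
        simp
  have hval : q (∑ i ∈ s, c i • boundedIndicator 𝕜 (A i))
      = ((∑ i ∈ s, ‖q (boundedIndicator 𝕜 (A i))‖ : ℝ) : 𝕜) := by
    simp [hc2]
  rw [hval, RCLike.norm_ofReal, mul_one] at key
  exact (le_abs_self _).trans key

theorem countable_ne_zero_of_almostDisjoint {q : (ℕ →ᵇ 𝕜) →L[𝕜] 𝕜}
    (hq : ∀ n, q (boundedIndicator 𝕜 {n}) = 0) {ι : Type*} {A : ι → Set ℕ}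
    (hA : ∀ i j, i ≠ j → (A i ∩ A j).Finite) :
    {i | q (boundedIndicator 𝕜 (A i)) ≠ 0}.Countable := by
  have h : Summable fun i => ‖q (boundedIndicator 𝕜 (A i))‖ :=
    summable_of_sum_le (fun _ => norm_nonneg _) (sum_norm_le_of_almostDisjoint hq hA)
  simpa [Function.support] using h.countable_support

/-- Countably many functionals on `ℓ^∞` that vanish on the unit sequences have a common zero which
is the indicator of an infinite set. -/
theorem exists_infinite_forall_eq_zero {q : ℕ → (ℕ →ᵇ 𝕜) →L[𝕜] 𝕜}
    (hq : ∀ m n, q m (boundedIndicator 𝕜 {n}) = 0) :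
    ∃ A : Set ℕ, A.Infinite ∧ ∀ m, q m (boundedIndicator 𝕜 A) = 0 := by
  obtain ⟨A, hinf, hA⟩ := exists_almostDisjoint_family
  have hcount := Set.countable_iUnion fun m => countable_ne_zero_of_almostDisjoint (hq m) hA
  have huniv : ¬ (Set.univ : Set (ℕ → Bool)).Countable := by
    rw [Set.countable_univ_iff, ← Cardinal.mk_le_aleph0_iff, not_le]
    simpa using Cardinal.cantor Cardinal.aleph0
  obtain ⟨r, hr⟩ : ∃ r, r ∉ ⋃ m, {i | q m (boundedIndicator 𝕜 (A i)) ≠ 0} := by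
    by_contra! h
    exact huniv (hcount.mono fun r _ => h r)
  exact ⟨A r, hinf r, fun m => by_contra fun hm => hr (Set.mem_iUnion.2 ⟨m, hm⟩)⟩

/-! ### Summing along bounded sequences -/

/-- If the interiors of the sets `Ks n` exhaust `K`, the `g n` are small on `Ks n`, and the finite
sums `∑ a n • g n` are bounded by a multiple of `‖a‖`, then `a ↦ ∑ a n • g n` is a bounded operator
from `ℓ^∞` to the bounded continuous functions on `K`. -/
theorem exists_sum_operator {K : Type*} [TopologicalSpace K]
    {Y : Type*} [NormedAddCommGroup Y] [NormedSpace 𝕜 Y] [CompleteSpace Y] {Ks : ℕ → Set K}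
    (hcover : ⋃ n, Ks n = Set.univ) (hinterior : ∀ n, Ks n ⊆ interior (Ks (n + 1)))
    {g : ℕ → K →ᵇ Y} {C : ℝ} (hC : 0 ≤ C)
    (hsmall : ∀ n, ∀ t ∈ Ks n, ‖g n t‖ ≤ (1 / 2) ^ n)
    (hbound : ∀ (a : ℕ →ᵇ 𝕜) (s : Finset ℕ), ‖∑ n ∈ s, a n • g n‖ ≤ C * ‖a‖) :
    ∃ T : (ℕ →ᵇ 𝕜) →L[𝕜] (K →ᵇ Y), ∀ n, T (boundedIndicator 𝕜 {n}) = g n := by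
  have hmono : Monotone Ks :=
    monotone_nat_of_le_succ fun n => (hinterior n).trans interior_subset
  let v : ℕ → ℕ → ℝ := fun m n => (1 / 2) ^ n + if n ∈ Finset.range m then ‖g n‖ else 0
  have hv : ∀ m, Summable (v m) := fun m =>
    summable_geometric_two.add
      (summable_of_ne_finset_zero (s := Finset.range m) fun n hn => if_neg hn)
  -- On `Ks m` the smallness hypothesis only applies to the terms with `m ≤ n`.
  have hle : ∀ (a : ℕ →ᵇ 𝕜) (m n : ℕ), ∀ t ∈ Ks m, ‖a n • g n t‖ ≤ ‖a‖ * v m n := by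
    intro a m n t ht
    rw [norm_smul]
    refine mul_le_mul (a.norm_coe_le_norm n) ?_ (norm_nonneg _) (norm_nonneg _)
    by_cases hn : n < m
    · simp only [v, Finset.mem_range, hn, if_true]
      exact ((g n).norm_coe_le_norm t).trans (le_add_of_nonneg_left (by positivity))
    · simp only [v, Finset.mem_range, hn, if_false, add_zero]
      exact hsmall n t (hmono (not_lt.1 hn) ht)
  have hmem : ∀ t, ∃ m, t ∈ Ks m := fun t => by
    simpa using (hcover ▸ Set.mem_univ t : t ∈ ⋃ n, Ks n)
  have hsum : ∀ (a : ℕ →ᵇ 𝕜) t, Summable fun n => a n • g n t := fun a t => by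
    obtain ⟨m, hm⟩ := hmem t
    exact ((hv m).mul_left ‖a‖).of_norm_bounded fun n => hle a m n t hm
  have hcont : ∀ a : ℕ →ᵇ 𝕜, Continuous fun t => ∑' n, a n • g n t := fun a => by
    rw [continuous_iff_continuousAt]
    intro t
    obtain ⟨m, hm⟩ := hmem t
    exact (continuousOn_tsum (fun n => ((g n).continuous.const_smul (a n)).continuousOn)
      ((hv (m + 1)).mul_left ‖a‖) (fun n => hle a (m + 1) n)).continuousAt
        (mem_interior_iff_mem_nhds.1 (hinterior m hm))
  have hnorm : ∀ (a : ℕ →ᵇ 𝕜) t, ‖∑' n, a n • g n t‖ ≤ C * ‖a‖ := fun a t => by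
    refine le_of_tendsto (hsum a t).hasSum.norm (Eventually.of_forall fun s => ?_)
    simpa using ((∑ n ∈ s, a n • g n).norm_coe_le_norm t).trans (hbound a s)
  refine ⟨LinearMap.mkContinuous
    { toFun := fun a => BoundedContinuousFunction.ofNormedAddCommGroup _ (hcont a) _ (hnorm a)
      map_add' := fun a b => ?_
      map_smul' := fun c a => ?_ } C fun a =>
      BoundedContinuousFunction.norm_ofNormedAddCommGroup_le _ (by positivity) (hnorm a), fun n => ?_⟩
  · ext t
    simp [add_smul, (hsum a t).tsum_add (hsum b t)]
  · ext t
    simp [mul_smul, (hsum a t).tsum_const_smul]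
  · ext t
    simp only [LinearMap.mkContinuous_apply, LinearMap.coe_mk, AddHom.coe_mk,
      BoundedContinuousFunction.coe_ofNormedAddCommGroup]
    rw [tsum_eq_single n fun m hm => by
        rw [boundedIndicator_of_notMem (by simpa using hm), zero_smul],
      boundedIndicator_of_mem (Set.mem_singleton _), one_smul]

end BoundedSequences

/-! ### The `c₀`-sum -/

section C0Sum

variable (𝕜 : Type*) [RCLike 𝕜] (X : ℕ → Type*)
  [∀ n, NormedAddCommGroup (X n)] [∀ n, NormedSpace 𝕜 (X n)]

theorem single_mem_c0Sum (n : ℕ) (x : X n) : lp.single ∞ n x ∈ c0Sum 𝕜 X := by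
  change Tendsto (fun i => ‖lp.single ∞ n x i‖) cofinite (𝓝 0)
  refine tendsto_const_nhds.congr' ?_
  filter_upwards [(Set.finite_singleton n).compl_mem_cofinite] with i hi
  rw [lp.single_apply_ne _ _ _ (by simpa using hi), norm_zero]

/-- The inclusion of the `n`-th summand in the `c₀`-sum. -/
noncomputable def c0SumSingle (n : ℕ) : X n →L[𝕜] c0Sum 𝕜 X :=
  (lp.singleContinuousLinearMap 𝕜 X ∞ n).codRestrict (c0Sum 𝕜 X) (single_mem_c0Sum 𝕜 X n)

/-- The `n`-th coordinate on the `c₀`-sum. -/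
noncomputable def c0SumCoord (n : ℕ) : c0Sum 𝕜 X →L[𝕜] X n :=
  LinearMap.mkContinuous
    { toFun := fun x => (x : lp X ∞) n
      map_add' := fun _ _ => rfl
      map_smul' := fun _ _ => rfl } 1 fun x => by
    rw [one_mul]
    exact lp.norm_apply_le_norm ENNReal.top_ne_zero (x : lp X ∞) n

variable {𝕜 X}

theorem c0SumCoord_single_self (n : ℕ) (x : X n) : c0SumCoord 𝕜 X n (c0SumSingle 𝕜 X n x) = x :=
  lp.single_apply_self ∞ n x

theorem c0SumCoord_single_of_ne {m n : ℕ} (h : m ≠ n) (x : X n) :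
    c0SumCoord 𝕜 X m (c0SumSingle 𝕜 X n x) = 0 :=
  lp.single_apply_ne ∞ n x h

theorem norm_c0Sum_le {x : c0Sum 𝕜 X} {C : ℝ} (hC : 0 ≤ C) (h : ∀ n, ‖c0SumCoord 𝕜 X n x‖ ≤ C) :
    ‖x‖ ≤ C :=
  lp.norm_le_of_forall_le hC h

theorem tendsto_norm_c0SumCoord (x : c0Sum 𝕜 X) :
    Tendsto (fun n => ‖c0SumCoord 𝕜 X n x‖) cofinite (𝓝 0) :=
  x.2

theorem norm_sum_c0SumSingle_le {x : ∀ n, X n} (hx : ∀ n, ‖x n‖ ≤ 1) (a : ℕ →ᵇ 𝕜)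
    (s : Finset ℕ) : ‖∑ n ∈ s, a n • c0SumSingle 𝕜 X n (x n)‖ ≤ ‖a‖ := by
  refine norm_c0Sum_le (norm_nonneg a) fun m => ?_
  rw [map_sum]
  by_cases hm : m ∈ s
  · rw [Finset.sum_eq_single_of_mem m hm fun n _ hn => by
      rw [map_smul, c0SumCoord_single_of_ne hn.symm, smul_zero]]
    rw [map_smul, c0SumCoord_single_self, norm_smul]
    exact (mul_le_mul (a.norm_coe_le_norm m) (hx m) (norm_nonneg _) (norm_nonneg _)).trans_eq
      (mul_one _)
  · rw [Finset.sum_eq_zero fun n hn => by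
      rw [map_smul, c0SumCoord_single_of_ne (ne_of_mem_of_not_mem hn hm).symm, smul_zero]]
    simp

end C0Sum

/-! ### Small unit vectors and the conclusion -/

theorem exists_unit_norm_le_of_not_linearlyEmbeds {𝕜 : Type*} [RCLike 𝕜] {X Y : Type*}
    [NormedAddCommGroup X] [NormedSpace 𝕜 X] [NormedAddCommGroup Y] [NormedSpace 𝕜 Y]
    (h : ¬ LinearlyEmbeds 𝕜 X Y) (T : X →L[𝕜] Y) {ε : ℝ} (hε : 0 < ε) :
    ∃ x : X, ‖x‖ = 1 ∧ ‖T x‖ ≤ ε := by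
  obtain ⟨u, hu⟩ : ∃ u, ‖T u‖ < ε * ‖u‖ := by
    by_contra! hcon
    exact h ⟨T, ε, hε, hcon⟩
  have hu0 : 0 < ‖u‖ := pos_of_mul_pos_right ((norm_nonneg _).trans_lt hu) hε.le
  refine ⟨((‖u‖⁻¹ : ℝ) : 𝕜) • u, ?_, ?_⟩
  · rw [norm_smul, RCLike.norm_ofReal, abs_of_pos (inv_pos.2 hu0), inv_mul_cancel₀ hu0.ne']
  · rw [map_smul, norm_smul, RCLike.norm_ofReal, abs_of_pos (inv_pos.2 hu0), inv_mul_le_iff₀ hu0,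
      mul_comm]
    exact hu.le

theorem HasComplementedCopy.exists_leftInverse {𝕜 : Type*} [RCLike 𝕜] {X Y : Type*}
    [NormedAddCommGroup X] [NormedSpace 𝕜 X] [NormedAddCommGroup Y] [NormedSpace 𝕜 Y]
    (h : HasComplementedCopy 𝕜 X Y) :
    ∃ (S : X →L[𝕜] Y) (R : Y →L[𝕜] X), ∀ x, R (S x) = x := by
  obtain ⟨Z, ⟨P, hP⟩, ⟨e⟩⟩ := h
  refine ⟨Z.subtypeL.comp (e : X →L[𝕜] Z), (e.symm : Z →L[𝕜] X).comp P, fun x => ?_⟩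
  simp [hP]

theorem theorem4p1 (𝕜 : Type*) [RCLike 𝕜]
    (K : Type*) [TopologicalSpace K]
    (Y : Type*) [NormedAddCommGroup Y] [NormedSpace 𝕜 Y] [CompleteSpace Y]
    (Ks : ℕ → Set K)
    (X : ℕ → Type*) [∀ n, NormedAddCommGroup (X n)] [∀ n, NormedSpace 𝕜 (X n)]
    [∀ n, CompleteSpace (X n)]
    (hcover : ⋃ n, Ks n = Set.univ)
    (hinterior : ∀ n, Ks n ⊆ interior (Ks (n + 1)))
    (hembed : ∀ n, ¬ LinearlyEmbeds 𝕜 (X n) (Ks n →ᵇ Y)) :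
    ¬ HasComplementedCopy 𝕜 (c0Sum 𝕜 X) (K →ᵇ Y) := by
  intro hcopy
  obtain ⟨S, R, hRS⟩ := hcopy.exists_leftInverse
  choose x hx1 hxsmall using fun n => exists_unit_norm_le_of_not_linearlyEmbeds (hembed n)
    ((BoundedContinuousFunction.compContinuousCLM Y 𝕜
      (⟨Subtype.val, continuous_subtype_val⟩ : C(Ks n, K))).comp (S.comp (c0SumSingle 𝕜 X n)))
    (ε := (1 / 2) ^ n) (by positivity)
  obtain ⟨T, hT⟩ := exists_sum_operator (𝕜 := 𝕜) hcover hinterior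
    (g := fun n => S (c0SumSingle 𝕜 X n (x n))) (norm_nonneg S)
    (fun n t ht => (BoundedContinuousFunction.norm_coe_le_norm _ (⟨t, ht⟩ : Ks n)).trans
      (hxsmall n))
    (fun a s => by
      simp only [← map_smul S, ← map_sum S]
      exact S.le_opNorm_of_le (norm_sum_c0SumSingle_le (fun n => (hx1 n).le) a s))
  choose φ hφ1 hφx using fun n => exists_dual_vector'' 𝕜 (x n)
  let q : ℕ → (ℕ →ᵇ 𝕜) →L[𝕜] 𝕜 := fun m =>
    BoundedContinuousFunction.evalCLM 𝕜 m - (φ m).comp ((c0SumCoord 𝕜 X m).comp (R.comp T))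
  have hqapp : ∀ m a, q m a = a m - φ m (c0SumCoord 𝕜 X m (R (T a))) := fun m a => rfl
  have hq : ∀ m n, q m (boundedIndicator 𝕜 {n}) = 0 := by
    intro m n
    rw [hqapp, hT, hRS]
    rcases eq_or_ne m n with rfl | hmn
    · rw [boundedIndicator_of_mem (Set.mem_singleton _), c0SumCoord_single_self, hφx, hx1, RCLike.ofReal_one,
        sub_self]
    · rw [boundedIndicator_of_notMem (by simpa using hmn), c0SumCoord_single_of_ne hmn, map_zero,
        sub_zero]
  obtain ⟨A, hAinf, hA⟩ := exists_infinite_forall_eq_zero hq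
  refine hAinf ((eventually_cofinite.1 ((tendsto_norm_c0SumCoord
    (R (T (boundedIndicator 𝕜 A)))).eventually (gt_mem_nhds one_pos))).subset fun n hn hlt => ?_)
  have h1 : φ n (c0SumCoord 𝕜 X n (R (T (boundedIndicator 𝕜 A)))) = 1 := by
    have h := hA n
    rw [hqapp, boundedIndicator_of_mem hn] at h
    exact (sub_eq_zero.1 h).symm
  have h2 := (φ n).le_of_opNorm_le (hφ1 n) (c0SumCoord 𝕜 X n (R (T (boundedIndicator 𝕜 A))))
  rw [h1, norm_one, one_mul] at h2
  exact hlt.not_ge h2
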